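/- Let $X\subset\mathbb R^n$ be compact (for instance a closed ball, or the closure of a bounded domain), let $\Omega=C([0,1];X)$ be the space of continuous paths with the uniform metric and its Borel $\sigma$-algebra, and let $\mu_0,\mu_1$ be Borel probability measures on $X$. Let $c:\Omega\to(-\infty,+\infty]$ be bounded from below, lower semicontinuous and coercive in the sense that $\{\gamma\in\Omega:|\gamma(0)|\le M,\ c(\gamma)\le N\}$ is compact for all $M,N>0$. Let $\theta,\beta>0$ and, for a finite nonnegative Borel measure $\pi$ on $\Omega$, put $$\mathcal U(\gamma;\pi)=\int_\Omega \mathcal K(\gamma,\sigma)\,d\pi(\sigma),\qquad \mathcal K(\gamma,\sigma)=\int_0^1\theta\, e^{-\beta|\gamma(t)-\sigma(t)|^2}\,dt .$$ Let $\Pi_{\mathrm{path}}(\mu_0,\mu_1)$ be the set of Borel probability measures $\pi$ on $\Omega$ whose images under $\gamma\mapsto\gamma(0)$ and $\gamma\mapsto\gamma(1)$ are $\mu_0$ and $\mu_1$ respectively. For continuous functions $\phi,\psi:X\to\mathbb R$ define the dual function $$\mathcal D(\phi,\psi)=\inf_{\pi\ge 0}\Big\{\int_\Omega\big(c(\gamma)+2\,\mathcal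 U(\gamma;\pi)-\phi(\gamma(0))-\psi(\gamma(1))\big)\,d\pi(\gamma)+\int_X\phi\,d\mu_0+\int_X\psi\,d\mu_1\Big\},$$ where the infimum runs over all finite nonnegative Borel measures $\pi$ on $\Omega$ (of arbitrary total mass). **Theorem.** Strong duality holds: $$\inf_{\pi\in\Pi_{\mathrm{path}}(\mu_0,\mu_1)}\int_\Omega\big(c(\gamma)+2\,\mathcal U(\gamma;\pi)\big)\,d\pi(\gamma)=\sup_{\phi,\psi\in C(X)}\mathcal D(\phi,\psi).$$ The equality holds in $[-\infty,+\infty]$; in particular both sides are $+\infty$ if no admissible $\pi$ has finite cost. -/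

import Mathlib

open MeasureTheory
open scoped ENNReal

noncomputable section

namespace PathTransport

/-- The space of continuous paths `γ : [0,1] → X`. Its topology is that of uniform convergence,
i.e. of the metric `max_t d(γ₁ t, γ₂ t)`. -/
abbrev PathSpace {n : ℕ} (X : Set (EuclideanSpace ℝ (Fin n))) : Type :=
  C(unitInterval, X)

/-- The path space carries its Borel σ-algebra. -/
instance pathMeasurableSpace {n : ℕ} (X : Set (EuclideanSpace ℝ (Fin n))) :
    MeasurableSpace (PathSpace X) := borel _

instance pathBorelSpace {n : ℕ} (X : Set (EuclideanSpace ℝ (Fin n))) :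
    BorelSpace (PathSpace X) := ⟨rfl⟩

/-- The evaluation map `e_t(γ) = γ(t)`. -/
def evalAt {n : ℕ} {X : Set (EuclideanSpace ℝ (Fin n))} (t : unitInterval)
    (γ : PathSpace X) : X := γ t

/-- The integral `∫ f dμ ∈ [-∞, +∞]` of an extended real valued function: the integral of the
positive part minus the integral of the negative part. It is used here only for measurable
functions bounded below and finite measures, so the negative part has finite integral. -/
def extIntegral {α : Type*} [MeasurableSpace α] (μ : Measure α) (f : α → EReal) : EReal :=
  ((∫⁻ a, (f a).toENNReal ∂μ : ℝ≥0∞) : EReal) - ((∫⁻ a, (-f a).toENNReal ∂μ : ℝ≥0∞) : EReal)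

/-- The condition on the cost of a path, a function with values in `(-∞, +∞]`: it is bounded from
below by a real number, lower semicontinuous, and coercive. -/
structure IsCoerciveCost {n : ℕ} {X : Set (EuclideanSpace ℝ (Fin n))}
    (c : PathSpace X → EReal) : Prop where
  bddBelow : ∃ B : ℝ, ∀ γ, (B : EReal) ≤ c γ
  lsc : LowerSemicontinuous c
  coercive : ∀ M N : ℝ, 0 < M → 0 < N →
    IsCompact {γ : PathSpace X |
      ‖(γ 0 : EuclideanSpace ℝ (Fin n))‖ ≤ M ∧ c γ ≤ (N : EReal)}

/-- The set `Π_path(μ₀, μ₁)` of admissible plans: probability measures `π` on the path space with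
`(e_0)_♯ π = μ₀` and `(e_1)_♯ π = μ₁`. -/
def pathPlans {n : ℕ} {X : Set (EuclideanSpace ℝ (Fin n))} (μ₀ μ₁ : ProbabilityMeasure X) :
    Set (ProbabilityMeasure (PathSpace X)) :=
  {π | (π : Measure (PathSpace X)).map (evalAt 0) = (μ₀ : Measure X) ∧
    (π : Measure (PathSpace X)).map (evalAt 1) = (μ₁ : Measure X)}

/-- The interaction kernel `K(γ, σ) = ∫_0^1 θ exp(-β |γ(t) - σ(t)|²) dt`. -/
def kernel {n : ℕ} {X : Set (EuclideanSpace ℝ (Fin n))} (θ β : ℝ) (γ σ : PathSpace X) : ℝ :=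
  ∫ t : unitInterval,
    θ * Real.exp (-β * ‖(γ t : EuclideanSpace ℝ (Fin n)) - (σ t : EuclideanSpace ℝ (Fin n))‖ ^ 2)

/-- The total interaction `U(γ; π) = ∫ K(γ, σ) dπ(σ)` of a path with a distribution of paths. -/
def interaction {n : ℕ} {X : Set (EuclideanSpace ℝ (Fin n))} (θ β : ℝ) (γ : PathSpace X)
    (π : Measure (PathSpace X)) : ℝ :=
  ∫ σ, kernel θ β γ σ ∂π

/-- The energy `E(π) = ∫ (c(γ) + 2 U(γ; π)) dπ(γ)`. -/
def energy {n : ℕ} {X : Set (EuclideanSpace ℝ (Fin n))} (c : PathSpace X → EReal) (θ β : ℝ)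
    (π : Measure (PathSpace X)) : EReal :=
  extIntegral π fun γ => c γ + ((2 * interaction θ β γ π : ℝ) : EReal)

/-- `Q(π; φ, ψ) = ∫ (c(γ) + 2 U(γ; π) - (φ(γ(0)) + ψ(γ(1)))) dπ(γ)`. -/
def reducedLagrangian {n : ℕ} {X : Set (EuclideanSpace ℝ (Fin n))} (c : PathSpace X → EReal)
    (θ β : ℝ) (φ ψ : C(X, ℝ)) (π : Measure (PathSpace X)) : EReal :=
  extIntegral π fun γ =>
    c γ + ((2 * interaction θ β γ π - (φ (evalAt 0 γ) + ψ (evalAt 1 γ)) : ℝ) : EReal)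

/-- The Lagrangian `L(π; φ, ψ) = Q(π; φ, ψ) + ∫ φ dμ₀ + ∫ ψ dμ₁`. -/
def lagrangian {n : ℕ} {X : Set (EuclideanSpace ℝ (Fin n))} (c : PathSpace X → EReal)
    (θ β : ℝ) (μ₀ μ₁ : ProbabilityMeasure X) (φ ψ : C(X, ℝ)) (π : Measure (PathSpace X)) :
    EReal :=
  reducedLagrangian c θ β φ ψ π +
    ((∫ x, φ x ∂(μ₀ : Measure X) + ∫ y, ψ y ∂(μ₁ : Measure X) : ℝ) : EReal)

/-- The dual function `D(φ, ψ) = inf_{π ≥ 0} L(π; φ, ψ)`, the infimum being over all finite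
nonnegative Borel measures on the path space, of any total mass. -/
def dualFunction {n : ℕ} {X : Set (EuclideanSpace ℝ (Fin n))} (c : PathSpace X → EReal)
    (θ β : ℝ) (μ₀ μ₁ : ProbabilityMeasure X) (φ ψ : C(X, ℝ)) : EReal :=
  ⨅ π : FiniteMeasure (PathSpace X), lagrangian c θ β μ₀ μ₁ φ ψ (π : Measure (PathSpace X))

end PathTransport

end

/-! One inequality is weak duality: at an admissible plan the constraint term of the Lagrangian
vanishes. The other combines compactness with separation in finite dimension, and needs no minimax
theorem.

With `c ≥ B`, the energy of a finite measure `π` is `∫ (c - B) dπ + B π(Ω) + 2 ∬ K dπ dπ`. Two facts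
about `K` matter. It is bounded below by some `κ > 0`, because `X` is bounded, so the quadratic term
grows like the squared mass and controls measures of arbitrary total mass. It is positive definite,
because a Gaussian is a convolution of Gaussians, so the energy is convex and weakly lower
semicontinuous. With coercivity of `c`, Prokhorov's theorem makes the energy sublevels weakly
compact (`isCompact_totalEnergy_le`).

Let `α` be below the primal value. Each `π` of energy at most `α` violates the constraints, so a
scaled multiplier makes its Lagrangian exceed `α`. This is an open condition on `π`, so finitely
many multipliers suffice on the sublevel; outside it the multiplier `0` works. Thus the maximum of
finitely many Lagrangians is at least `α`. They are convex in `π`, so separation yields a convex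
combination that is still at least `α` (`exists_weights_of_forall_exists_le`). As the Lagrangian is
affine in the multiplier, the same combination of multipliers is the required one
(`exists_multiplier_of_lt_totalEnergy`). -/

namespace PathTransport

open Filter Topology Set
open scoped NNReal BoundedContinuousFunction

set_option linter.unusedSectionVars false

/-! ### Lower semicontinuity of integrals under weak convergence -/

section LowerSemicontinuity

variable {Ω : Type*} [TopologicalSpace Ω] [TopologicalSpace.MetrizableSpace Ω]

/-- A lower semicontinuous function with values in `[0, ∞]` is the supremum of the bounded
continuous functions below it. -/
theorem isLUB_continuous_le {k : Ω → ℝ≥0∞} (hk : LowerSemicontinuous k) :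
    IsLUB {f : Ω → ℝ≥0∞ | (Continuous f ∧ ∃ C : ℝ≥0, ∀ x, f x ≤ C) ∧ f ≤ k} k := by
  refine ⟨fun f hf => hf.2, fun u hu x => ?_⟩
  refine le_of_forall_lt fun a ha => ?_
  obtain ⟨b, hab, hbk⟩ := ENNReal.lt_iff_exists_nnreal_btwn.1 ha
  have hopen : IsOpen {y | (b : ℝ≥0∞) < k y} := hk.isOpen_preimage b
  -- Urysohn: the bump `b φ` equals `b` at `x` and vanishes where `k ≤ b`, so it stays below `k`.
  obtain ⟨φ, hφ0, hφ1, hφ⟩ := exists_continuous_zero_one_of_isClosed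
    (s := {y | (b : ℝ≥0∞) < k y}ᶜ) (t := {x}) hopen.isClosed_compl isClosed_singleton
    (by simpa using hbk)
  let f : Ω → ℝ≥0∞ := fun y => ((b * Real.toNNReal (φ y) : ℝ≥0) : ℝ≥0∞)
  have hf : Continuous f := ENNReal.continuous_coe.comp (by fun_prop)
  have hfb : ∀ y, f y ≤ b := fun y => by
    have : Real.toNNReal (φ y) ≤ 1 := by simpa using (hφ y).2
    exact ENNReal.coe_le_coe.2 (mul_le_of_le_one_right' this)
  have hfk : f ≤ k := by
    intro y
    by_cases hy : (b : ℝ≥0∞) < k y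
    · exact (hfb y).trans hy.le
    · have : φ y = 0 := hφ0 hy
      simp [f, this]
  have hfx : f x = b := by
    have : φ x = 1 := hφ1 rfl
    simp [f, this]
  calc a < b := hab
    _ = f x := hfx.symm
    _ ≤ u x := hu ⟨⟨hf, b, hfb⟩, hfk⟩ x

variable [SecondCountableTopology Ω]

/-- A lower semicontinuous function with values in `[0, ∞]` is the supremum of an increasing
sequence of bounded continuous functions. -/
theorem exists_monotone_seq_continuous_iSup {k : Ω → ℝ≥0∞} (hk : LowerSemicontinuous k) :
    ∃ g : ℕ → Ω → ℝ≥0∞, Monotone g ∧ (∀ n, Continuous (g n) ∧ ∃ C : ℝ≥0, ∀ x, g n x ≤ C) ∧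
      ∀ x, ⨆ n, g n x = k x := by
  obtain ⟨F, hF, hFc, hlub⟩ := exists_countable_lowerSemicontinuous_isLUB
    (fun f hf => hf.1.1.lowerSemicontinuous) (isLUB_continuous_le hk)
  -- Adding `0` leaves the supremum unchanged and makes the family nonempty, hence enumerable by
  -- `ℕ`.
  obtain ⟨f, hf⟩ := (hFc.insert 0).exists_eq_range (insert_nonempty _ _)
  have hfc : ∀ n, Continuous (f n) ∧ ∃ C : ℝ≥0, ∀ x, f n x ≤ C := fun n => by
    have : f n ∈ insert 0 F := hf ▸ mem_range_self n
    rcases this with h | h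
    · exact ⟨h ▸ continuous_const, 0, by simp [h]⟩
    · exact (hF h).1
  have hlub' : IsLUB (range f) k := by
    rw [← hf]
    refine ⟨?_, fun u hu => hlub.2 fun v hv => hu (mem_insert_of_mem _ hv)⟩
    rintro v (rfl | hv)
    · exact fun x => bot_le
    · exact hlub.1 hv
  refine ⟨partialSups f, (partialSups f).monotone, fun n => ?_, fun x => ?_⟩
  · induction n with
    | zero => simpa using hfc 0
    | succ n ih =>
      obtain ⟨h1, C, hC⟩ := ih
      obtain ⟨h2, D, hD⟩ := hfc (n + 1)
      rw [partialSups_add_one]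
      refine ⟨h1.max h2, max C D, fun x => ?_⟩
      rw [ENNReal.coe_max]
      exact max_le_max (hC x) (hD x)
  · have hx : ⨆ n, f n x = k x := by
      have := isLUB_pi.1 hlub' x
      rw [← range_comp] at this
      exact this.iSup_eq
    rw [← hx]
    simpa only [iSup_apply] using congr_fun (iSup_partialSups_eq f) x

variable [MeasurableSpace Ω] [BorelSpace Ω]

/-- The integral of a lower semicontinuous function with values in `[0, ∞]` is lower semicontinuous
for the weak topology on finite measures. -/
theorem lowerSemicontinuous_lintegral {k : Ω → ℝ≥0∞} (hk : LowerSemicontinuous k) :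
    LowerSemicontinuous fun π : FiniteMeasure Ω => ∫⁻ γ, k γ ∂(π : Measure Ω) := by
  obtain ⟨g, hmono, hg, hsup⟩ := exists_monotone_seq_continuous_iSup hk
  have h : (fun π : FiniteMeasure Ω => ∫⁻ γ, k γ ∂(π : Measure Ω)) =
      fun π : FiniteMeasure Ω => ⨆ n, ∫⁻ γ, g n γ ∂(π : Measure Ω) := by
    ext π
    rw [← lintegral_iSup (fun n => (hg n).1.measurable) hmono]
    simp_rw [hsup]
  rw [h]
  refine lowerSemicontinuous_iSup fun n => ?_
  obtain ⟨hc, C, hC⟩ := hg n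
  have hne : ∀ x, g n x ≠ ∞ := fun x => ne_top_of_le_ne_top ENNReal.coe_ne_top (hC x)
  have hle : ∀ x, (g n x).toNNReal ≤ C := fun x => by
    rw [← ENNReal.coe_le_coe, ENNReal.coe_toNNReal (hne x)]
    exact hC x
  let G : Ω →ᵇ ℝ≥0 := BoundedContinuousFunction.mkOfBound
    ⟨fun y => (g n y).toNNReal, ENNReal.continuousOn_toNNReal.comp_continuous hc hne⟩ C
    (fun y z => by
      rw [NNReal.dist_eq, abs_le]
      have hy : (((g n y).toNNReal : ℝ≥0) : ℝ) ≤ C := by exact_mod_cast hle y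
      have hz : (((g n z).toNNReal : ℝ≥0) : ℝ) ≤ C := by exact_mod_cast hle z
      have h0y := NNReal.coe_nonneg (g n y).toNNReal
      have h0z := NNReal.coe_nonneg (g n z).toNNReal
      simp only [ContinuousMap.coe_mk]
      constructor <;> linarith)
  have hG : ∀ x, g n x = G x := fun x => (ENNReal.coe_toNNReal (hne x)).symm
  simp_rw [hG]
  exact (FiniteMeasure.continuous_lintegral_boundedContinuousFunction G).lowerSemicontinuous

end LowerSemicontinuity

/-! ### Separation in finite dimension -/

/-- If every point of a convex subset of `ℝ^ι` has a coordinate at least `α`, then some convex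
combination of the coordinates is at least `α` on the whole set. -/
theorem exists_weights_of_forall_exists_le {ι : Type*} [Fintype ι] [Nonempty ι] {G : Set (ι → ℝ)}
    (hG : Convex ℝ G) {α : ℝ} (h : ∀ x ∈ G, ∃ i, α ≤ x i) :
    ∃ w : ι → ℝ, (∀ i, 0 ≤ w i) ∧ ∑ i, w i = 1 ∧ ∀ x ∈ G, α ≤ ∑ i, w i * x i := by
  classical
  rcases G.eq_empty_or_nonempty with rfl | ⟨x₀, hx₀⟩
  · obtain ⟨i⟩ := ‹Nonempty ι›
    exact ⟨Pi.single i 1, fun j => by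
      by_cases hj : j = i
      · subst hj; simp
      · simp [hj], by simp, by simp⟩
  -- By hypothesis `G` misses the open orthant of points with all coordinates below `α`; the
  -- separating functional, normalised, gives the weights.
  have hopen : IsOpen (univ.pi fun _ : ι => Iio α) := isOpen_set_pi finite_univ fun _ _ => isOpen_Iio
  have hconv : Convex ℝ (univ.pi fun _ : ι => Iio α) := convex_pi fun _ _ => convex_Iio α
  obtain ⟨f, u, hlt, hge⟩ := geometric_hahn_banach_open hconv hopen hG (by
    refine disjoint_left.2 fun x hx hxG => ?_
    obtain ⟨i, hi⟩ := h x hxG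
    exact absurd (hx i (mem_univ i)) (not_lt.2 hi))
  let l : ι → ℝ := fun i => f (Pi.single i 1)
  have hf : ∀ x, f x = ∑ i, l i * x i := fun x => by
    have hx : x = ∑ i, x i • (Pi.single i (1 : ℝ) : ι → ℝ) := by
      ext j
      simp [Finset.sum_apply, Pi.single_apply]
    conv_lhs => rw [hx]
    simp only [map_sum, map_smul, smul_eq_mul, l]
    exact Finset.sum_congr rfl fun i _ => mul_comm _ _
  -- The orthant is unbounded in the direction `-e_i`, and `f < u` on it; a negative `l i` would let
  -- `f` exceed `u` there.
  have hl : ∀ i, 0 ≤ l i := fun i => by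
    by_contra! hneg
    obtain ⟨t, ht⟩ : ∃ t : ℝ, 0 ≤ t ∧ u < f (fun _ => α - 1) - t * l i := by
      refine ⟨max 0 ((u + 1 - f (fun _ => α - 1)) / (-l i)), le_max_left _ _, ?_⟩
      have h1 := le_max_right 0 ((u + 1 - f (fun _ => α - 1)) / (-l i))
      rw [div_le_iff₀ (by linarith)] at h1
      linarith
    have := hlt ((fun _ => α - 1) - t • (Pi.single i (1 : ℝ) : ι → ℝ)) (fun j _ => by
      by_cases hj : j = i
      · subst hj
        simp only [Pi.sub_apply, Pi.smul_apply, Pi.single_eq_same, smul_eq_mul, mem_Iio]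
        linarith [ht.1]
      · simp [hj])
    rw [map_sub, map_smul, smul_eq_mul] at this
    linarith [ht.2]
  have hsum : 0 < ∑ i, l i := by
    refine lt_of_le_of_ne (Finset.sum_nonneg fun i _ => hl i) fun h0 => ?_
    have hz : ∀ i, l i = 0 := fun i =>
      (Finset.sum_eq_zero_iff_of_nonneg fun i _ => hl i).1 h0.symm i (Finset.mem_univ i)
    have h1 := hlt (fun _ => α - 1) (fun i _ => by simp)
    have h2 := hge x₀ hx₀
    simp [hf, hz] at h1 h2
    linarith
  -- Approach the corner `(α, …, α)` from inside the orthant, at a distance that costs exactly `ε`.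
  have hα : α * ∑ i, l i ≤ u := by
    refine le_of_forall_pos_le_add fun ε hε => ?_
    have := hlt (fun _ => α - ε / ∑ i, l i) (fun i _ => by
      have : 0 < ε / ∑ i, l i := by positivity
      simpa using this)
    rw [hf, ← Finset.sum_mul] at this
    have h2 : (∑ i, l i) * (ε / ∑ i, l i) = ε := by field_simp
    rw [mul_sub, h2] at this
    linarith
  refine ⟨fun i => l i / ∑ i, l i, fun i => div_nonneg (hl i) hsum.le, ?_, fun x hx => ?_⟩
  · rw [← Finset.sum_div, div_self hsum.ne']
  · have h3 := hge x hx
    rw [hf] at h3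
    have : ∑ i, l i / (∑ i, l i) * x i = (∑ i, l i * x i) / ∑ i, l i := by
      rw [Finset.sum_div]
      exact Finset.sum_congr rfl fun i _ => by ring
    rw [this, le_div_iff₀ hsum]
    linarith

/-! ### Quadratic energies of convex kernels -/

section Duality

variable {Ω : Type*} [MeasurableSpace Ω]

/-- The bilinear energy `∬ K(γ, σ) dπ'(σ) dπ(γ)` of two measures. -/
noncomputable def crossEnergy (K : Ω → Ω → ℝ) (π π' : Measure Ω) : ℝ :=
  ∫ γ, ∫ σ, K γ σ ∂π' ∂π

variable [TopologicalSpace Ω]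

/-- A bounded continuous kernel, bounded below by a positive constant, whose quadratic energy is
convex on finite measures. -/
structure IsConvexKernel (K : Ω → Ω → ℝ) : Prop where
  continuous : Continuous (Function.uncurry K)
  pos : ∃ κ : ℝ, 0 < κ ∧ ∀ x y, κ ≤ K x y
  bdd : ∃ C : ℝ, ∀ x y, K x y ≤ C
  convex : ∀ π π' : FiniteMeasure Ω, crossEnergy K π π' + crossEnergy K π' π ≤
    crossEnergy K π π + crossEnergy K π' π'

/-- The integral against a finite measure, as a linear form on bounded continuous functions. -/
noncomputable def integralLinear [OpensMeasurableSpace Ω] (π : FiniteMeasure Ω) :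
    (Ω →ᵇ ℝ) →ₗ[ℝ] ℝ where
  toFun f := ∫ x, f x ∂(π : Measure Ω)
  map_add' f g := integral_add (f.integrable _) (g.integrable _)
  map_smul' a _ := integral_const_mul a _

theorem IsConvexKernel.exists_abs_le {K : Ω → Ω → ℝ} (hK : IsConvexKernel K) : ∃ C : ℝ, 0 ≤ C ∧ ∀ x y, |K x y| ≤ C := by
  obtain ⟨κ, hκ, hκK⟩ := hK.pos
  obtain ⟨C, hC⟩ := hK.bdd
  exact ⟨max C 0, le_max_right _ _, fun x y => by
    rw [abs_of_pos (hκ.trans_le (hκK x y))]; exact (hC x y).trans (le_max_left _ _)⟩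

variable [BorelSpace Ω]

theorem integrable_of_continuous_of_bounded {f : Ω → ℝ} (hf : Continuous f) {C : ℝ}
    (hC : ∀ x, |f x| ≤ C) (π : Measure Ω) [IsFiniteMeasure π] : Integrable f π :=
  Integrable.of_bound hf.aestronglyMeasurable C (.of_forall hC)

theorem continuous_integral_of_bounded {f : Ω → ℝ} (hf : Continuous f) {C : ℝ}
    (hC : ∀ x, |f x| ≤ C) : Continuous fun π : FiniteMeasure Ω => ∫ x, f x ∂(π : Measure Ω) :=
  FiniteMeasure.continuous_integral_boundedContinuousFunction
    (BoundedContinuousFunction.ofNormedAddCommGroup f hf C hC)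

variable [SecondCountableTopology Ω] [TopologicalSpace.MetrizableSpace Ω]

theorem integral_combination {f : Ω → ℝ} (hf : Continuous f) {C : ℝ} (hC : ∀ x, |f x| ≤ C)
    (s t : ℝ≥0) (π π' : FiniteMeasure Ω) :
    ∫ x, f x ∂((s • π + t • π' : FiniteMeasure Ω) : Measure Ω) =
      s * ∫ x, f x ∂(π : Measure Ω) + t * ∫ x, f x ∂(π' : Measure Ω) := by
  rw [FiniteMeasure.toMeasure_add, integral_add_measure
    (integrable_of_continuous_of_bounded hf hC _) (integrable_of_continuous_of_bounded hf hC _),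
    FiniteMeasure.toMeasure_smul, FiniteMeasure.toMeasure_smul, integral_smul_nnreal_measure,
    integral_smul_nnreal_measure]
  rfl

namespace IsConvexKernel

variable {K : Ω → Ω → ℝ}

theorem integrable_prod (hK : IsConvexKernel K) (π π' : FiniteMeasure Ω) :
    Integrable (Function.uncurry K) ((π : Measure Ω).prod (π' : Measure Ω)) := by
  obtain ⟨C, -, hC⟩ := hK.exists_abs_le
  exact Integrable.of_bound hK.continuous.aestronglyMeasurable C (.of_forall fun p => hC p.1 p.2)

theorem crossEnergy_swap (hK : IsConvexKernel K) (π π' : FiniteMeasure Ω) :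
    crossEnergy K π π' = crossEnergy (fun x y => K y x) π' π :=
  integral_integral_swap (hK.integrable_prod π π')

/-- Symmetry of `K` is not assumed; passing to the transposed kernel carries statements about one
argument of `crossEnergy` to the other. -/
theorem flip (hK : IsConvexKernel K) : IsConvexKernel fun x y => K y x where
  continuous := hK.continuous.comp continuous_swap
  pos := hK.pos.imp fun _ h => ⟨h.1, fun x y => h.2 y x⟩
  bdd := hK.bdd.imp fun _ h x y => h y x
  convex π π' := by
    have := hK.convex π π'
    rw [hK.crossEnergy_swap, hK.crossEnergy_swap π', hK.crossEnergy_swap π π,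
      hK.crossEnergy_swap π' π'] at this
    linarith

theorem continuous_potential (hK : IsConvexKernel K) (π : FiniteMeasure Ω) :
    Continuous fun γ => ∫ σ, K γ σ ∂(π : Measure Ω) := by
  obtain ⟨C, -, hC⟩ := hK.exists_abs_le
  exact continuous_of_dominated (bound := fun _ => C)
    (fun x => (hK.continuous.comp (Continuous.prodMk_right x)).aestronglyMeasurable)
    (fun x => .of_forall fun y => hC x y) (integrable_const C)
    (.of_forall fun y => hK.continuous.comp (Continuous.prodMk_left y))

theorem exists_potential_abs_le (hK : IsConvexKernel K) (π : FiniteMeasure Ω) :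
    ∃ C : ℝ, ∀ γ, |∫ σ, K γ σ ∂(π : Measure Ω)| ≤ C := by
  obtain ⟨C, -, hC⟩ := hK.exists_abs_le
  exact ⟨C * (π : Measure Ω).real univ, fun γ =>
    norm_integral_le_of_norm_le_const (μ := (π : Measure Ω)) (f := K γ) (.of_forall (hC γ))⟩

theorem continuous_crossEnergy_left (hK : IsConvexKernel K) (π' : FiniteMeasure Ω) :
    Continuous fun π : FiniteMeasure Ω => crossEnergy K π π' := by
  obtain ⟨C, hC⟩ := hK.exists_potential_abs_le π'
  exact continuous_integral_of_bounded (hK.continuous_potential π') hC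

theorem continuous_crossEnergy_right (hK : IsConvexKernel K) (π : FiniteMeasure Ω) :
    Continuous fun π' : FiniteMeasure Ω => crossEnergy K π π' := by
  simp_rw [hK.crossEnergy_swap π]
  exact hK.flip.continuous_crossEnergy_left π

/-- Convexity puts the quadratic energy above its tangent at `π₀`, which is weakly continuous in `π`
and touches it at `π₀`. Weak continuity of product measures is not needed. -/
theorem lowerSemicontinuous_crossEnergy (hK : IsConvexKernel K) :
    LowerSemicontinuous fun π : FiniteMeasure Ω => crossEnergy K π π := by
  intro π₀ a ha
  have hc : Continuous fun π : FiniteMeasure Ω =>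
      crossEnergy K π π₀ + crossEnergy K π₀ π - crossEnergy K π₀ π₀ :=
    ((hK.continuous_crossEnergy_left π₀).add (hK.continuous_crossEnergy_right π₀)).sub
      continuous_const
  have hev := (hc.tendsto π₀).eventually_const_lt (u := a) (by simpa using ha)
  filter_upwards [hev] with π hπ
  linarith [hK.convex π π₀]

theorem crossEnergy_combination_left (hK : IsConvexKernel K) (s t : ℝ≥0)
    (π π' ρ : FiniteMeasure Ω) :
    crossEnergy K ((s • π + t • π' : FiniteMeasure Ω) : Measure Ω) ρ =
      s * crossEnergy K π ρ + t * crossEnergy K π' ρ := by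
  obtain ⟨C, hC⟩ := hK.exists_potential_abs_le ρ
  exact integral_combination (hK.continuous_potential ρ) hC s t π π'

/-- Since `s + t = 1`, the convexity defect is `s t` times the defect in `IsConvexKernel.convex`. -/
theorem crossEnergy_combination_le (hK : IsConvexKernel K) {s t : ℝ≥0} (hst : s + t = 1)
    (π π' : FiniteMeasure Ω) :
    crossEnergy K ((s • π + t • π' : FiniteMeasure Ω) : Measure Ω)
        ((s • π + t • π' : FiniteMeasure Ω) : Measure Ω) ≤
      s * crossEnergy K π π + t * crossEnergy K π' π' := by
  have hright : ∀ ρ : FiniteMeasure Ω,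
      crossEnergy K ρ ((s • π + t • π' : FiniteMeasure Ω) : Measure Ω) =
        s * crossEnergy K ρ π + t * crossEnergy K ρ π' := fun ρ => by
    rw [hK.crossEnergy_swap, hK.flip.crossEnergy_combination_left, hK.crossEnergy_swap ρ,
      hK.crossEnergy_swap ρ]
  rw [hK.crossEnergy_combination_left, hright, hright]
  have hst' : (s : ℝ) + t = 1 := by exact_mod_cast hst
  have h0 : 0 ≤ (s : ℝ) * t := by positivity
  have h1 := mul_le_mul_of_nonneg_left (hK.convex π π') h0
  have ht : (t : ℝ) = 1 - s := by linarith
  rw [ht] at h1 ⊢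
  nlinarith [h1]

theorem exists_le_crossEnergy (hK : IsConvexKernel K) :
    ∃ κ : ℝ, 0 < κ ∧ ∀ π : FiniteMeasure Ω,
      κ * (π : Measure Ω).real univ ^ 2 ≤ crossEnergy K π π := by
  obtain ⟨κ, hκ, hκK⟩ := hK.pos
  refine ⟨κ, hκ, fun π => ?_⟩
  obtain ⟨C, -, hC⟩ := hK.exists_abs_le
  obtain ⟨D, hD⟩ := hK.exists_potential_abs_le π
  have h1 : ∀ γ, κ * (π : Measure Ω).real univ ≤ ∫ σ, K γ σ ∂(π : Measure Ω) := fun γ => by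
    calc κ * (π : Measure Ω).real univ = ∫ _, κ ∂(π : Measure Ω) := by
          rw [integral_const, smul_eq_mul, mul_comm]
      _ ≤ _ := integral_mono (integrable_const κ) (integrable_of_continuous_of_bounded
          (hK.continuous.comp (Continuous.prodMk_right γ)) (hC γ) _) (hκK γ)
  calc κ * (π : Measure Ω).real univ ^ 2
      = ∫ _, κ * (π : Measure Ω).real univ ∂(π : Measure Ω) := by
        rw [integral_const, smul_eq_mul]; ring
    _ ≤ _ := integral_mono (integrable_const _) (integrable_of_continuous_of_bounded
        (hK.continuous_potential π) hD _) h1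

end IsConvexKernel

/-! ### The total energy: compact sublevels and multipliers -/

/-- The total energy `∫ k dπ + B π(Ω) + 2 ∬ K dπ dπ`. -/
noncomputable def totalEnergy (k : Ω → ℝ≥0∞) (K : Ω → Ω → ℝ) (B : ℝ) (π : FiniteMeasure Ω) :
    EReal :=
  ((∫⁻ γ, k γ ∂(π : Measure Ω) : ℝ≥0∞) : EReal) +
    ((B * (π : Measure Ω).real univ + 2 * crossEnergy K π π : ℝ) : EReal)

variable {k : Ω → ℝ≥0∞} {K : Ω → Ω → ℝ} {B : ℝ}

theorem lowerSemicontinuous_totalEnergy (hk : LowerSemicontinuous k) (hK : IsConvexKernel K)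
    (B : ℝ) : LowerSemicontinuous (totalEnergy k K B) := by
  have hmass : Continuous fun π : FiniteMeasure Ω => B * (π : Measure Ω).real univ := by
    have := continuous_integral_of_bounded (Ω := Ω) (f := fun _ => B) continuous_const
      (C := |B|) fun _ => le_rfl
    simpa [integral_const, mul_comm] using this
  have hquad : LowerSemicontinuous fun π : FiniteMeasure Ω => 2 * crossEnergy K π π :=
    (continuous_const_mul (2 : ℝ)).comp_lowerSemicontinuous hK.lowerSemicontinuous_crossEnergy
      fun x y hxy => by simpa using hxy
  refine LowerSemicontinuous.add'
    (continuous_coe_ennreal_ereal.comp_lowerSemicontinuous (lowerSemicontinuous_lintegral hk)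
      EReal.coe_ennreal_strictMono.monotone)
    (continuous_coe_real_ereal.comp_lowerSemicontinuous (hmass.lowerSemicontinuous.add hquad)
      EReal.coe_strictMono.monotone) fun π => ?_
  exact EReal.continuousAt_add (.inr (EReal.coe_ne_bot _)) (.inr (EReal.coe_ne_top _))

/-- Complete the square in the mass `x`: the minimum of `B x + 2 κ x²` over the reals is `-B² / (8
κ)`. -/
theorem exists_le_totalEnergy (hK : IsConvexKernel K) (B : ℝ) :
    ∃ C : ℝ, ∀ π : FiniteMeasure Ω,
      -C ≤ B * (π : Measure Ω).real univ + 2 * crossEnergy K π π := by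
  obtain ⟨κ, hκ, h⟩ := hK.exists_le_crossEnergy
  refine ⟨B ^ 2 / (8 * κ), fun π => ?_⟩
  have h1 := h π
  set x := (π : Measure Ω).real univ
  have h2 : 2 * κ * (x + B / (4 * κ)) ^ 2 = B * x + 2 * (κ * x ^ 2) + B ^ 2 / (8 * κ) := by
    field_simp; ring
  have h3 : 0 ≤ 2 * κ * (x + B / (4 * κ)) ^ 2 := by positivity
  linarith

/-- The sublevel sets of the total energy are compact if those of `k` are. -/
theorem isCompact_totalEnergy_le (hk : LowerSemicontinuous k)
    (hkc : ∀ N : ℝ≥0, IsCompact {γ | k γ ≤ N}) (hK : IsConvexKernel K) (B α : ℝ) :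
    IsCompact {π : FiniteMeasure Ω | totalEnergy k K B π ≤ α} := by
  obtain ⟨κ, hκ, hκK⟩ := hK.exists_le_crossEnergy
  -- Quadratic growth beats the linear term, so the mass is bounded on the sublevel; the final `+ 1`
  -- in the witness ensures `x > 1`.
  obtain ⟨M, hM⟩ : ∃ M : ℝ, ∀ x : ℝ, B * x + 2 * (κ * x ^ 2) ≤ α → x ≤ M := by
    refine ⟨(|α| + |B| + 1) / (2 * κ) + 1, fun x hx => ?_⟩
    by_contra! hlt
    have hpos : 0 < (|α| + |B| + 1) / (2 * κ) := by positivity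
    have h1 : |α| + |B| + 1 < 2 * κ * x := by
      have : (|α| + |B| + 1) / (2 * κ) < x := by linarith
      rwa [div_lt_iff₀' (by positivity)] at this
    have hx1 : 1 < x := by linarith
    have h2 : (|α| + |B| + 1) * x ≤ 2 * (κ * x ^ 2) := by nlinarith
    have h3 : -(|B| * x) ≤ B * x := by nlinarith [neg_abs_le B]
    nlinarith [le_abs_self α, abs_nonneg α, mul_nonneg (abs_nonneg α) (by linarith : 0 ≤ x - 1)]
  obtain ⟨C, hC⟩ := exists_le_totalEnergy (Ω := Ω) hK B
  let A : ℝ≥0 := (α + C).toNNReal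
  have key : ∀ π : FiniteMeasure Ω, totalEnergy k K B π ≤ α →
      π.mass ≤ M.toNNReal ∧ ∫⁻ γ, k γ ∂(π : Measure Ω) ≤ A := by
    intro π hπ
    unfold totalEnergy at hπ
    have hne : ∫⁻ γ, k γ ∂(π : Measure Ω) ≠ ∞ := fun h => by
      rw [h, EReal.coe_ennreal_top, EReal.top_add_coe] at hπ
      exact absurd hπ (by simp)
    lift ∫⁻ γ, k γ ∂(π : Measure Ω) to ℝ≥0 using hne with I hI
    have hreal : (I : ℝ) + (B * (π : Measure Ω).real univ + 2 * crossEnergy K π π) ≤ α := by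
      have : ((I : ℝ≥0∞) : EReal) = ((I : ℝ) : EReal) := EReal.coe_nnreal_eq_coe_real I
      rw [this] at hπ
      exact_mod_cast hπ
    have hI0 : (0 : ℝ) ≤ I := I.2
    constructor
    · rw [← NNReal.coe_le_coe]
      have : (π.mass : ℝ) = (π : Measure Ω).real univ := rfl
      rw [this]
      exact (hM _ (by linarith [hκK π])).trans (Real.le_coe_toNNReal M)
    · have : (I : ℝ) ≤ A := by
        refine le_trans ?_ (Real.le_coe_toNNReal _)
        linarith [hC π]
      exact_mod_cast this
  -- Prokhorov: `∫ k dπ ≤ A` and Markov's inequality bound the mass outside the compact set `{k ≤ n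
  -- + 1}` by `A / (n + 1)`, uniformly in `π`.
  have hcpt := isCompact_setOfPred_finiteMeasure_mass_le_compl_isCompact_le (E := Ω)
    (u := fun n : ℕ => A / ((n : ℝ≥0) + 1)) (K := fun n : ℕ => {γ | k γ ≤ ((n + 1 : ℝ≥0) : ℝ≥0∞)})
    M.toNNReal (by
      rw [← NNReal.tendsto_coe]
      simpa [Function.comp_def] using
        (tendsto_const_div_atTop_nhds_zero_nat (A : ℝ)).comp (tendsto_add_atTop_nat 1))
    (fun n => hkc _) (.inl inferInstance)
  refine hcpt.of_isClosed_subset ?_ fun π hπ => ?_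
  · exact (lowerSemicontinuous_totalEnergy hk hK B).isClosed_preimage α
  · obtain ⟨h1, h2⟩ := key π hπ
    refine ⟨h1, fun n => ?_⟩
    rw [← ENNReal.coe_le_coe, FiniteMeasure.ennreal_coeFn_eq_coeFn_toMeasure,
      ENNReal.coe_div (by positivity)]
    refine le_trans (measure_mono fun γ hγ => ?_) ((meas_ge_le_lintegral_div
      (ε := ((n + 1 : ℝ≥0) : ℝ≥0∞)) hk.measurable.aemeasurable (by simp) (by simp)).trans
      (ENNReal.div_le_div_right h2 _))
    rw [mem_compl_iff, mem_ofPred_eq, not_le] at hγ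
    exact hγ.le

/-- Strong duality for a convex energy under linear constraints: if the energy exceeds `α` at every
finite measure satisfying the constraints, then some multiplier makes the Lagrangian at least `α`
at every finite measure. -/
theorem exists_multiplier_of_lt_totalEnergy {V : Type*} [AddCommGroup V] [Module ℝ V]
    (hk : LowerSemicontinuous k) (hkc : ∀ N : ℝ≥0, IsCompact {γ | k γ ≤ N})
    (hK : IsConvexKernel K) (T : V →ₗ[ℝ] (Ω →ᵇ ℝ)) (m : V →ₗ[ℝ] ℝ) {α : ℝ}
    (h : ∀ π : FiniteMeasure Ω, (∀ v, ∫ x, T v x ∂(π : Measure Ω) = m v) →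
      (α : EReal) < totalEnergy k K B π) :
    ∃ v, ∀ π : FiniteMeasure Ω,
      (α : EReal) ≤ totalEnergy k K B π + ((m v - ∫ x, T v x ∂(π : Measure Ω) : ℝ) : EReal) := by
  classical
  let D : FiniteMeasure Ω → V →ₗ[ℝ] ℝ := fun π => m - integralLinear π ∘ₗ T
  have hD : ∀ π v, D π v = m v - ∫ x, T v x ∂(π : Measure Ω) := fun _ _ => rfl
  obtain ⟨C, hC⟩ := exists_le_totalEnergy (Ω := Ω) hK B
  -- The energy is at least `-C`, so `D π v > α + C` forces the Lagrangian above `α`. If `D π v ≠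
  -- 0`, rescaling `v` makes it equal to `α + C + 1`.
  obtain ⟨t, ht⟩ := (isCompact_totalEnergy_le hk hkc hK B α).elim_finite_subcover
    (fun v => {π | α + C < D π v}) (fun v => by
      simp_rw [hD]
      exact isOpen_lt continuous_const (continuous_const.sub
        (FiniteMeasure.continuous_integral_boundedContinuousFunction (T v)))) (by
      intro π hπ
      obtain ⟨v, hv⟩ : ∃ v, D π v ≠ 0 := by
        by_contra! hall
        refine absurd (h π fun v => ?_) (not_lt.2 hπ)
        linarith [hall v, hD π v]
      refine mem_iUnion.2 ⟨((α + C + 1) / D π v) • v, ?_⟩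
      change α + C < D π _
      rw [map_smul, smul_eq_mul, div_mul_cancel₀ _ hv]
      linarith)
  let e : FiniteMeasure Ω → ℝ := fun π => (∫⁻ γ, k γ ∂(π : Measure Ω)).toReal +
    (B * (π : Measure Ω).real univ + 2 * crossEnergy K π π)
  have he : ∀ π : FiniteMeasure Ω, ∫⁻ γ, k γ ∂(π : Measure Ω) ≠ ∞ →
      totalEnergy k K B π = (e π : EReal) := fun π hπ => by
    rw [totalEnergy, ← EReal.coe_ennreal_toReal hπ, ← EReal.coe_add]
  -- The multiplier `0` serves the measures whose energy already exceeds `α`.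
  let ι := ↥(insert 0 t)
  have : Nonempty ι := ⟨⟨0, Finset.mem_insert_self _ _⟩⟩
  -- Taking all vectors above the Lagrangian values, not just the values, makes `G` convex. Infinite
  -- cost is excluded because `toReal` would send it to `0`.
  let G : Set (ι → ℝ) := {x | ∃ π : FiniteMeasure Ω, ∫⁻ γ, k γ ∂(π : Measure Ω) ≠ ∞ ∧
    ∀ v : ι, e π + D π v ≤ x v}
  have hG : Convex ℝ G := by
    rintro x ⟨π, hπ, hx⟩ y ⟨π', hπ', hy⟩ a b ha hb hab
    lift a to ℝ≥0 using ha
    lift b to ℝ≥0 using hb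
    have hab' : a + b = 1 := by exact_mod_cast hab
    have hI : ∫⁻ γ, k γ ∂((a • π + b • π' : FiniteMeasure Ω) : Measure Ω) =
        a * ∫⁻ γ, k γ ∂(π : Measure Ω) + b * ∫⁻ γ, k γ ∂(π' : Measure Ω) := by
      rw [FiniteMeasure.toMeasure_add, lintegral_add_measure, FiniteMeasure.toMeasure_smul,
        FiniteMeasure.toMeasure_smul, lintegral_smul_measure, lintegral_smul_measure]
      rfl
    have hm : ((a • π + b • π' : FiniteMeasure Ω) : Measure Ω).real univ =
        a * (π : Measure Ω).real univ + b * (π' : Measure Ω).real univ := by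
      simpa [integral_const] using integral_combination (Ω := Ω) (f := fun _ => (1 : ℝ))
        continuous_const (C := 1) (by simp) a b π π'
    have h1 : a * ∫⁻ γ, k γ ∂(π : Measure Ω) ≠ ∞ := ENNReal.mul_ne_top ENNReal.coe_ne_top hπ
    have h2 : b * ∫⁻ γ, k γ ∂(π' : Measure Ω) ≠ ∞ := ENNReal.mul_ne_top ENNReal.coe_ne_top hπ'
    refine ⟨a • π + b • π', by rw [hI]; exact ENNReal.add_ne_top.2 ⟨h1, h2⟩, fun v => ?_⟩
    have hT : D (a • π + b • π') v = a * D π v + b * D π' v := by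
      rw [hD, hD, hD, integral_combination (T v).continuous (T v).norm_coe_le_norm]
      linear_combination (-m v) * hab
    have hee : e (a • π + b • π') ≤ a * e π + b * e π' := by
      simp only [e]
      rw [hI, hm, ENNReal.toReal_add h1 h2, ENNReal.toReal_mul, ENNReal.toReal_mul]
      simp only [ENNReal.coe_toReal]
      linarith [hK.crossEnergy_combination_le hab' π π']
    have hx' := mul_le_mul_of_nonneg_left (hx v) a.2
    have hy' := mul_le_mul_of_nonneg_left (hy v) b.2
    simp only [Pi.add_apply, Pi.smul_apply, smul_eq_mul, hT]
    simp only [NNReal.val_eq_coe] at hx' hy'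
    linarith
  obtain ⟨w, hw0, hw1, hw⟩ := exists_weights_of_forall_exists_le hG (α := α) (by
    rintro x ⟨π, hπ, hx⟩
    by_cases hle : totalEnergy k K B π ≤ α
    · obtain ⟨v, hv, hvD⟩ := mem_iUnion₂.1 (ht hle)
      refine ⟨⟨v, Finset.mem_insert_of_mem hv⟩, le_trans ?_ (hx _)⟩
      have h1 := hC π
      have h2 : 0 ≤ (∫⁻ γ, k γ ∂(π : Measure Ω)).toReal := ENNReal.toReal_nonneg
      have h3 : α + C < D π v := hvD
      simp only [e]
      linarith
    · refine ⟨⟨0, Finset.mem_insert_self _ _⟩, le_trans ?_ (hx _)⟩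
      rw [he π hπ, not_le, EReal.coe_lt_coe_iff] at hle
      simpa using hle.le)
  refine ⟨∑ i, w i • (i : V), fun π => ?_⟩
  by_cases hπ : ∫⁻ γ, k γ ∂(π : Measure Ω) = ∞
  · rw [totalEnergy, hπ, EReal.coe_ennreal_top, EReal.top_add_coe, EReal.top_add_coe]
    exact le_top
  · rw [he π hπ, ← hD, ← EReal.coe_add, EReal.coe_le_coe_iff]
    have := hw (fun v => e π + D π v) ⟨π, hπ, fun v => le_rfl⟩
    simp only [mul_add, Finset.sum_add_distrib, ← Finset.sum_mul, hw1, one_mul] at this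
    simpa [map_sum, map_smul] using this

end Duality

/-! ### Positive definiteness of the Gaussian kernel -/

section Gaussian

variable {E : Type*} [NormedAddCommGroup E] [InnerProductSpace ℝ E]

/-- The product of two translates of a Gaussian is a multiple of a Gaussian. -/
theorem exp_neg_sq_norm_mul_exp_neg_sq_norm (β : ℝ) (x y z : E) :
    Real.exp (-(2 * β) * ‖x - z‖ ^ 2) * Real.exp (-(2 * β) * ‖y - z‖ ^ 2) =
      Real.exp (-β * ‖x - y‖ ^ 2) *
        Real.exp (-(4 * β) * ‖z - (1 / 2 : ℝ) • (x + y)‖ ^ 2) := by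
  rw [← Real.exp_add, ← Real.exp_add]
  have h := parallelogram_law_with_norm ℝ (x - z) (y - z)
  have h1 : x - z + (y - z) = (-2 : ℝ) • (z - (1 / 2 : ℝ) • (x + y)) := by module
  have h2 : x - z - (y - z) = x - y := by abel
  rw [h1, h2, norm_smul, norm_neg, Real.norm_two] at h
  congr 1
  linear_combination (-β) * (-h)

variable [FiniteDimensional ℝ E] [MeasurableSpace E] [BorelSpace E]

theorem integral_exp_neg_sq_norm_pos {b : ℝ} (hb : 0 < b) :
    0 < ∫ z : E, Real.exp (-b * ‖z‖ ^ 2) := by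
  rw [GaussianFourier.integral_rexp_neg_mul_sq_norm hb]
  positivity

/-- A non-integrable function has integral `0` by convention, so a positive integral forces
integrability. -/
theorem integrable_exp_neg_sq_norm {b : ℝ} (hb : 0 < b) :
    Integrable fun z : E => Real.exp (-b * ‖z‖ ^ 2) :=
  not_imp_comm.1 integral_undef (integral_exp_neg_sq_norm_pos hb).ne'

theorem integrable_exp_mul_exp {β : ℝ} (hβ : 0 < β) (x y : E) :
    Integrable fun z : E =>
      Real.exp (-(2 * β) * ‖x - z‖ ^ 2) * Real.exp (-(2 * β) * ‖y - z‖ ^ 2) := by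
  simp_rw [exp_neg_sq_norm_mul_exp_neg_sq_norm]
  exact ((integrable_exp_neg_sq_norm (by positivity : 0 < 4 * β)).comp_sub_right _).const_mul _

theorem integral_exp_mul_exp (β : ℝ) (x y : E) :
    ∫ z : E, Real.exp (-(2 * β) * ‖x - z‖ ^ 2) * Real.exp (-(2 * β) * ‖y - z‖ ^ 2) =
      Real.exp (-β * ‖x - y‖ ^ 2) * ∫ z : E, Real.exp (-(4 * β) * ‖z‖ ^ 2) := by
  simp_rw [exp_neg_sq_norm_mul_exp_neg_sq_norm, integral_const_mul]
  rw [integral_sub_right_eq_self fun z : E => Real.exp (-(4 * β) * ‖z‖ ^ 2)]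

theorem integrable_prod_exp_mul_exp {β : ℝ} (hβ : 0 < β) (ν ν' : Measure E)
    [IsFiniteMeasure ν] [IsFiniteMeasure ν'] :
    Integrable (fun q : (E × E) × E =>
      Real.exp (-(2 * β) * ‖q.1.1 - q.2‖ ^ 2) * Real.exp (-(2 * β) * ‖q.1.2 - q.2‖ ^ 2))
      ((ν.prod ν').prod volume) := by
  have hc : Continuous fun q : (E × E) × E =>
      Real.exp (-(2 * β) * ‖q.1.1 - q.2‖ ^ 2) * Real.exp (-(2 * β) * ‖q.1.2 - q.2‖ ^ 2) := by
    fun_prop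
  refine (integrable_prod_iff hc.aestronglyMeasurable).2
    ⟨.of_forall fun p => integrable_exp_mul_exp hβ p.1 p.2, ?_⟩
  have hn : ∀ p : E × E, ∫ z : E, ‖Real.exp (-(2 * β) * ‖p.1 - z‖ ^ 2) *
      Real.exp (-(2 * β) * ‖p.2 - z‖ ^ 2)‖ =
      Real.exp (-β * ‖p.1 - p.2‖ ^ 2) * ∫ z : E, Real.exp (-(4 * β) * ‖z‖ ^ 2) := fun p => by
    rw [← integral_exp_mul_exp]
    exact integral_congr_ae (.of_forall fun z => Real.norm_of_nonneg (by positivity))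
  simp_rw [hn]
  refine Integrable.mul_const (Integrable.of_bound (by fun_prop) 1 (.of_forall fun p => ?_)) _
  rw [Real.norm_of_nonneg (by positivity), Real.exp_le_one_iff]
  have : 0 ≤ β * ‖p.1 - p.2‖ ^ 2 := by positivity
  linarith

/-- The Gaussian energy of two measures is an `L²` inner product of their Gaussian smoothings. -/
theorem crossEnergy_gaussian {β : ℝ} (hβ : 0 < β) (ν ν' : Measure E)
    [IsFiniteMeasure ν] [IsFiniteMeasure ν'] :
    crossEnergy (fun x y : E => Real.exp (-β * ‖x - y‖ ^ 2)) ν ν' *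
        ∫ z : E, Real.exp (-(4 * β) * ‖z‖ ^ 2) =
      ∫ z : E, (∫ x, Real.exp (-(2 * β) * ‖x - z‖ ^ 2) ∂ν) *
        ∫ y, Real.exp (-(2 * β) * ‖y - z‖ ^ 2) ∂ν' := by
  have hswap := integral_integral_swap (μ := ν.prod ν') (ν := (volume : Measure E))
    (f := fun p z => Real.exp (-(2 * β) * ‖p.1 - z‖ ^ 2) * Real.exp (-(2 * β) * ‖p.2 - z‖ ^ 2))
    (integrable_prod_exp_mul_exp hβ ν ν')
  simp_rw [integral_exp_mul_exp, integral_mul_const] at hswap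
  rw [integral_prod] at hswap
  · rw [crossEnergy, hswap]
    exact integral_congr_ae (.of_forall fun z =>
      integral_prod_mul (fun x => Real.exp (-(2 * β) * ‖x - z‖ ^ 2))
        (fun y => Real.exp (-(2 * β) * ‖y - z‖ ^ 2)))
  · refine Integrable.of_bound (by fun_prop) 1 (.of_forall fun p => ?_)
    rw [Real.norm_of_nonneg (by positivity), Real.exp_le_one_iff]
    have : 0 ≤ β * ‖p.1 - p.2‖ ^ 2 := by positivity
    linarith

/-- The Gaussian kernel is positive definite on differences of finite measures. -/
theorem crossEnergy_gaussian_add_le {β : ℝ} (hβ : 0 < β) (ν ν' : Measure E)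
    [IsFiniteMeasure ν] [IsFiniteMeasure ν'] :
    crossEnergy (fun x y : E => Real.exp (-β * ‖x - y‖ ^ 2)) ν ν' +
        crossEnergy (fun x y : E => Real.exp (-β * ‖x - y‖ ^ 2)) ν' ν ≤
      crossEnergy (fun x y : E => Real.exp (-β * ‖x - y‖ ^ 2)) ν ν +
        crossEnergy (fun x y : E => Real.exp (-β * ‖x - y‖ ^ 2)) ν' ν' := by
  have hint : ∀ (ρ ρ' : Measure E) [IsFiniteMeasure ρ] [IsFiniteMeasure ρ'],
      Integrable fun z : E => (∫ x, Real.exp (-(2 * β) * ‖x - z‖ ^ 2) ∂ρ) *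
        ∫ y, Real.exp (-(2 * β) * ‖y - z‖ ^ 2) ∂ρ' := fun ρ ρ' _ _ => by
    refine (integrable_prod_exp_mul_exp hβ ρ ρ').integral_prod_right.congr
      (.of_forall fun z => ?_)
    exact integral_prod_mul (fun x => Real.exp (-(2 * β) * ‖x - z‖ ^ 2))
      (fun y => Real.exp (-(2 * β) * ‖y - z‖ ^ 2))
  refine le_of_mul_le_mul_right ?_
    (integral_exp_neg_sq_norm_pos (E := E) (by positivity : 0 < 4 * β))
  rw [add_mul, add_mul, crossEnergy_gaussian hβ, crossEnergy_gaussian hβ, crossEnergy_gaussian hβ,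
    crossEnergy_gaussian hβ, ← integral_add (hint ν ν') (hint ν' ν),
    ← integral_add (hint ν ν) (hint ν' ν')]
  refine integral_mono ((hint ν ν').add (hint ν' ν)) ((hint ν ν).add (hint ν' ν')) fun z => ?_
  dsimp only
  -- Pointwise this is `2ab ≤ a² + b²` for the two smoothings at `z`.
  nlinarith [sq_nonneg ((∫ x, Real.exp (-(2 * β) * ‖x - z‖ ^ 2) ∂ν) -
    ∫ x, Real.exp (-(2 * β) * ‖x - z‖ ^ 2) ∂ν')]

end Gaussian

/-- Integrating out one variable of a bounded continuous function preserves continuity. -/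
theorem continuous_integral_right {A S : Type*} [TopologicalSpace A] [FirstCountableTopology A]
    [TopologicalSpace S] [SecondCountableTopology S] [MeasurableSpace S] [OpensMeasurableSpace S]
    {μ : Measure S} [IsFiniteMeasure μ] {f : A × S → ℝ} (hf : Continuous f) {C : ℝ}
    (hC : ∀ q, ‖f q‖ ≤ C) : Continuous fun a => ∫ s, f (a, s) ∂μ :=
  continuous_of_dominated (bound := fun _ => C)
    (fun a => (hf.comp (Continuous.prodMk_right a)).aestronglyMeasurable)
    (fun a => .of_forall fun s => hC (a, s)) (integrable_const C)
    (.of_forall fun s => hf.comp (Continuous.prodMk_left s))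

/-! ### The interaction kernel on path space -/

section Kernel

variable {n : ℕ} {X : Set (EuclideanSpace ℝ (Fin n))}

theorem continuous_evalAt (t : unitInterval) :
    Continuous (evalAt t : PathSpace X → X) :=
  continuous_eval_const t

theorem continuous_kernel_integrand (θ β : ℝ) :
    Continuous fun q : (PathSpace X × PathSpace X) × unitInterval =>
      θ * Real.exp (-β * ‖(q.1.1 q.2 : EuclideanSpace ℝ (Fin n)) - q.1.2 q.2‖ ^ 2) := by
  have h1 : Continuous fun q : (PathSpace X × PathSpace X) × unitInterval =>
      (q.1.1 q.2 : EuclideanSpace ℝ (Fin n)) :=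
    continuous_subtype_val.comp ((continuous_fst.comp continuous_fst).eval continuous_snd)
  have h2 : Continuous fun q : (PathSpace X × PathSpace X) × unitInterval =>
      (q.1.2 q.2 : EuclideanSpace ℝ (Fin n)) :=
    continuous_subtype_val.comp ((continuous_snd.comp continuous_fst).eval continuous_snd)
  fun_prop

theorem abs_kernel_integrand_le {θ β : ℝ} (hθ : 0 < θ) (hβ : 0 < β) (γ σ : PathSpace X)
    (t : unitInterval) :
    ‖θ * Real.exp (-β * ‖(γ t : EuclideanSpace ℝ (Fin n)) - σ t‖ ^ 2)‖ ≤ θ := by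
  rw [Real.norm_of_nonneg (by positivity)]
  refine mul_le_of_le_one_right hθ.le (Real.exp_le_one_iff.2 ?_)
  have : 0 ≤ β * ‖(γ t : EuclideanSpace ℝ (Fin n)) - σ t‖ ^ 2 := by positivity
  linarith

theorem continuous_kernel {θ β : ℝ} (hθ : 0 < θ) (hβ : 0 < β) :
    Continuous (Function.uncurry (kernel θ β : PathSpace X → PathSpace X → ℝ)) := by
  exact continuous_integral_right (μ := volume) (continuous_kernel_integrand (X := X) θ β)
    fun q => abs_kernel_integrand_le hθ hβ q.1.1 q.1.2 q.2

theorem integrable_kernel_integrand {θ β : ℝ} (hθ : 0 < θ) (hβ : 0 < β)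
    (π π' : FiniteMeasure (PathSpace X)) :
    Integrable (fun q : (PathSpace X × PathSpace X) × unitInterval =>
      θ * Real.exp (-β * ‖(q.1.1 q.2 : EuclideanSpace ℝ (Fin n)) - q.1.2 q.2‖ ^ 2))
      (((π : Measure (PathSpace X)).prod (π' : Measure (PathSpace X))).prod volume) :=
  Integrable.of_bound (continuous_kernel_integrand θ β).aestronglyMeasurable θ
    (.of_forall fun q => abs_kernel_integrand_le hθ hβ q.1.1 q.1.2 q.2)

/-- At a fixed time the kernel sees only the positions `γ t`, so pushing forward to `ℝⁿ` reduces the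
energy to the Gaussian one. -/
theorem integral_prod_kernel_integrand {θ β : ℝ} (hθ : 0 < θ) (hβ : 0 < β)
    (π π' : FiniteMeasure (PathSpace X)) (t : unitInterval) :
    ∫ p : PathSpace X × PathSpace X,
        θ * Real.exp (-β * ‖(p.1 t : EuclideanSpace ℝ (Fin n)) - p.2 t‖ ^ 2)
        ∂((π : Measure (PathSpace X)).prod (π' : Measure (PathSpace X))) =
      θ * crossEnergy (fun x y : EuclideanSpace ℝ (Fin n) => Real.exp (-β * ‖x - y‖ ^ 2))
        ((π : Measure (PathSpace X)).map fun γ => (γ t : EuclideanSpace ℝ (Fin n)))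
        ((π' : Measure (PathSpace X)).map fun γ => (γ t : EuclideanSpace ℝ (Fin n))) := by
  have hm : Continuous fun γ : PathSpace X => (γ t : EuclideanSpace ℝ (Fin n)) :=
    continuous_subtype_val.comp (continuous_evalAt t)
  have hin : ∀ x : EuclideanSpace ℝ (Fin n),
      ∫ y, Real.exp (-β * ‖x - y‖ ^ 2)
        ∂((π' : Measure (PathSpace X)).map fun γ => (γ t : EuclideanSpace ℝ (Fin n))) =
      ∫ σ : PathSpace X, Real.exp (-β * ‖x - σ t‖ ^ 2) ∂(π' : Measure (PathSpace X)) := fun x =>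
    integral_map hm.measurable.aemeasurable
      (by fun_prop : Continuous fun y => Real.exp (-β * ‖x - y‖ ^ 2)).aestronglyMeasurable
  rw [integral_prod, crossEnergy]
  · simp_rw [integral_const_mul]
    rw [integral_map hm.measurable.aemeasurable]
    · simp_rw [hin]
    · exact (StronglyMeasurable.integral_prod_right (f := fun x y : EuclideanSpace ℝ (Fin n) =>
        Real.exp (-β * ‖x - y‖ ^ 2)) (by
          apply Continuous.stronglyMeasurable
          simp only [Function.uncurry_def]
          fun_prop)).aestronglyMeasurable
  · exact Integrable.of_bound ((continuous_kernel_integrand θ β).comp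
      (Continuous.prodMk_left t)).aestronglyMeasurable θ
      (.of_forall fun p => abs_kernel_integrand_le hθ hβ p.1 p.2 t)

/-- Fubini puts time outermost, so that convexity can be checked at each time separately. -/
theorem crossEnergy_kernel {θ β : ℝ} (hθ : 0 < θ) (hβ : 0 < β)
    (π π' : FiniteMeasure (PathSpace X)) :
    crossEnergy (kernel θ β) (π : Measure (PathSpace X)) (π' : Measure (PathSpace X)) =
      ∫ t : unitInterval, ∫ p : PathSpace X × PathSpace X,
        θ * Real.exp (-β * ‖(p.1 t : EuclideanSpace ℝ (Fin n)) - p.2 t‖ ^ 2)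
        ∂((π : Measure (PathSpace X)).prod (π' : Measure (PathSpace X))) := by
  have hint := integrable_kernel_integrand hθ hβ π π'
  rw [← integral_integral_swap hint,
    integral_prod _ hint.integral_prod_left]
  rfl

theorem isConvexKernel_kernel (hX : IsCompact X) {θ β : ℝ} (hθ : 0 < θ) (hβ : 0 < β) :
    IsConvexKernel (kernel θ β : PathSpace X → PathSpace X → ℝ) where
  continuous := continuous_kernel hθ hβ
  pos := by
    obtain ⟨R, hR⟩ := hX.isBounded.exists_norm_le
    -- Paths in a ball of radius `R` are never more than `2R` apart.
    refine ⟨θ * Real.exp (-β * (R + R) ^ 2), by positivity, fun γ σ => ?_⟩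
    have hc := (continuous_kernel_integrand (X := X) θ β).comp (Continuous.prodMk_right (γ, σ))
    calc θ * Real.exp (-β * (R + R) ^ 2)
        = ∫ _ : unitInterval, θ * Real.exp (-β * (R + R) ^ 2) := by simp
      _ ≤ kernel θ β γ σ := integral_mono (integrable_const _)
          (Integrable.of_bound hc.aestronglyMeasurable θ
            (.of_forall fun t => abs_kernel_integrand_le hθ hβ γ σ t)) fun t => ?_
    have hd : ‖(γ t : EuclideanSpace ℝ (Fin n)) - σ t‖ ≤ R + R :=
      (norm_sub_le _ _).trans (add_le_add (hR _ (γ t).2) (hR _ (σ t).2))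
    simp only [neg_mul]
    gcongr
  bdd := ⟨θ, fun γ σ => by
    have h := norm_integral_le_of_norm_le_const (μ := (volume : Measure unitInterval))
      (.of_forall fun t => abs_kernel_integrand_le hθ hβ γ σ t)
    rw [probReal_univ, mul_one] at h
    exact (le_abs_self _).trans h⟩
  convex π π' := by
    have hint : ∀ ρ ρ' : FiniteMeasure (PathSpace X), Integrable fun t : unitInterval =>
        ∫ p : PathSpace X × PathSpace X,
          θ * Real.exp (-β * ‖(p.1 t : EuclideanSpace ℝ (Fin n)) - p.2 t‖ ^ 2)
          ∂((ρ : Measure (PathSpace X)).prod (ρ' : Measure (PathSpace X))) := fun ρ ρ' =>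
      (integrable_kernel_integrand hθ hβ ρ ρ').integral_prod_right
    rw [crossEnergy_kernel hθ hβ, crossEnergy_kernel hθ hβ, crossEnergy_kernel hθ hβ,
      crossEnergy_kernel hθ hβ, ← integral_add (hint π π') (hint π' π),
      ← integral_add (hint π π) (hint π' π')]
    refine integral_mono ((hint π π').add (hint π' π)) ((hint π π).add (hint π' π')) fun t => ?_
    dsimp only
    rw [integral_prod_kernel_integrand hθ hβ, integral_prod_kernel_integrand hθ hβ,
      integral_prod_kernel_integrand hθ hβ, integral_prod_kernel_integrand hθ hβ, ← mul_add,
      ← mul_add]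
    exact mul_le_mul_of_nonneg_left (crossEnergy_gaussian_add_le hβ _ _) hθ.le

end Kernel

/-! ### Extended integrals and the path cost -/

/-- The extended integral of `k + g` with `k ≥ 0` measurable and `g` real and integrable. -/
theorem extIntegral_coe_add {α : Type*} [MeasurableSpace α] {μ : Measure α} {k : α → ℝ≥0∞}
    (hk : Measurable k) {g : α → ℝ} (hgm : Measurable g) (hg : Integrable g μ) :
    extIntegral μ (fun a => (k a : EReal) + (g a : EReal)) =
      ((∫⁻ a, k a ∂μ : ℝ≥0∞) : EReal) + ((∫ a, g a ∂μ : ℝ) : EReal) := by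
  -- For `f = k + g` the identity is `f⁺ + g⁻ = k + g⁺ + f⁻`, free of subtraction and hence valid
  -- when `k = ∞`. The bound `f⁻ ≤ g⁻` makes the negative part integrable.
  have hpt : ∀ a, ((k a : EReal) + (g a : EReal)).toENNReal + ENNReal.ofReal (-g a) =
      k a + ENNReal.ofReal (g a) + (-((k a : EReal) + (g a : EReal))).toENNReal ∧
      (-((k a : EReal) + (g a : EReal))).toENNReal ≤ ENNReal.ofReal (-g a) := by
    intro a
    rcases eq_or_ne (k a) ∞ with h | h
    · simp [h]
    · lift k a to ℝ≥0 using h with r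
      rw [EReal.coe_nnreal_eq_coe_real, ← EReal.coe_add, ← EReal.coe_neg,
        EReal.toENNReal_of_ne_top (EReal.coe_ne_top _),
        EReal.toENNReal_of_ne_top (EReal.coe_ne_top _), EReal.toReal_coe, EReal.toReal_coe]
      have hr : (0 : ℝ) ≤ r := r.2
      constructor
      · rw [← ENNReal.ofReal_coe_nnreal, ENNReal.ofReal, ENNReal.ofReal, ENNReal.ofReal,
          ENNReal.ofReal, ENNReal.ofReal, ← ENNReal.coe_add, ← ENNReal.coe_add, ← ENNReal.coe_add,
          ENNReal.coe_inj, ← NNReal.coe_inj]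
        push_cast
        simp only [Real.coe_toNNReal']
        rcases le_total 0 (g a) with h1 | h1 <;> rcases le_total 0 ((r : ℝ) + g a) with h2 | h2 <;>
          simp only [max_def] <;> split_ifs <;> linarith
      · exact ENNReal.ofReal_le_ofReal (by linarith)
  have hfm : Measurable fun a => (k a : EReal) + (g a : EReal) :=
    hk.coe_ereal_ennreal.add hgm.coe_real_ereal
  have hPm : Measurable fun a => ((k a : EReal) + (g a : EReal)).toENNReal :=
    hfm.ereal_toENNReal
  have hsum : ∫⁻ a, ((k a : EReal) + (g a : EReal)).toENNReal ∂μ +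
      ∫⁻ a, ENNReal.ofReal (-g a) ∂μ = ∫⁻ a, k a ∂μ + ∫⁻ a, ENNReal.ofReal (g a) ∂μ +
        ∫⁻ a, (-((k a : EReal) + (g a : EReal))).toENNReal ∂μ := by
    rw [← lintegral_add_left hPm, ← lintegral_add_left hk, ← lintegral_add_left
      (f := fun a => k a + ENNReal.ofReal (g a)) (hk.add hgm.ennreal_ofReal)]
    exact lintegral_congr fun a => (hpt a).1
  have hpos : ∫⁻ a, ENNReal.ofReal (g a) ∂μ ≠ ∞ := hg.lintegral_lt_top.ne
  have hneg : ∫⁻ a, ENNReal.ofReal (-g a) ∂μ ≠ ∞ := hg.neg.lintegral_lt_top.ne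
  have hN : ∫⁻ a, (-((k a : EReal) + (g a : EReal))).toENNReal ∂μ ≠ ∞ :=
    ne_top_of_le_ne_top hneg (lintegral_mono fun a => (hpt a).2)
  rw [extIntegral, integral_eq_lintegral_pos_part_sub_lintegral_neg_part hg]
  generalize ∫⁻ a, ((k a : EReal) + (g a : EReal)).toENNReal ∂μ = P at *
  generalize ∫⁻ a, (-((k a : EReal) + (g a : EReal))).toENNReal ∂μ = N at *
  generalize ∫⁻ a, ENNReal.ofReal (g a) ∂μ = p at *
  generalize ∫⁻ a, ENNReal.ofReal (-g a) ∂μ = q at *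
  generalize ∫⁻ a, k a ∂μ = I at *
  lift N to ℝ≥0 using hN
  lift p to ℝ≥0 using hpos
  lift q to ℝ≥0 using hneg
  rcases eq_or_ne I ∞ with rfl | hI
  · have hP : P = ∞ := by
      by_contra hP
      lift P to ℝ≥0 using hP
      simp [← ENNReal.coe_add] at hsum
    rw [hP, EReal.coe_ennreal_top, EReal.top_add_coe, EReal.coe_nnreal_eq_coe_real,
      EReal.top_sub_coe]
  · lift I to ℝ≥0 using hI
    have hP : P ≠ ∞ := fun hP => by simp [hP, ← ENNReal.coe_add] at hsum
    lift P to ℝ≥0 using hP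
    have hs : (P : ℝ) + q = I + p + N := by exact_mod_cast hsum
    rw [EReal.coe_nnreal_eq_coe_real, EReal.coe_nnreal_eq_coe_real, EReal.coe_nnreal_eq_coe_real,
      ← EReal.coe_sub, ← EReal.coe_add, EReal.coe_eq_coe_iff]
    simp only [ENNReal.coe_toReal]
    linarith

section Cost

variable {n : ℕ} {X : Set (EuclideanSpace ℝ (Fin n))} {c : PathSpace X → EReal} {B : ℝ}

/-- The excess of a cost over a lower bound `B`. -/
noncomputable def excess (c : PathSpace X → EReal) (B : ℝ) (γ : PathSpace X) : ℝ≥0∞ :=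
  (c γ - B).toENNReal

theorem coe_excess_add (hB : ∀ γ, (B : EReal) ≤ c γ) (γ : PathSpace X) :
    (excess c B γ : EReal) + B = c γ := by
  have h0 : 0 ≤ c γ - B := EReal.sub_nonneg (.inr (EReal.coe_ne_top _)) (.inr (EReal.coe_ne_bot _))
    |>.2 (hB γ)
  rw [excess, EReal.coe_toENNReal h0]
  exact EReal.sub_add_cancel

theorem lt_excess_iff (hB : ∀ γ, (B : EReal) ≤ c γ) (γ : PathSpace X) (y : ℝ≥0∞) :
    y < excess c B γ ↔ (y : EReal) + B < c γ := by
  rw [← coe_excess_add hB γ, ← EReal.coe_ennreal_lt_coe_ennreal_iff]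
  refine ⟨fun h => EReal.add_lt_add_right_coe h B, fun h => ?_⟩
  by_contra! hle
  exact absurd h (not_lt.2 (add_le_add_left hle _))

theorem lowerSemicontinuous_excess (hc : LowerSemicontinuous c) (hB : ∀ γ, (B : EReal) ≤ c γ) :
    LowerSemicontinuous (excess c B) := by
  rw [lowerSemicontinuous_iff_isOpen_preimage]
  intro y
  have : excess c B ⁻¹' Ioi y = c ⁻¹' Ioi ((y : EReal) + B) := by
    ext γ
    exact lt_excess_iff hB γ y
  rw [this]
  exact hc.isOpen_preimage _

theorem isCompact_excess_le (hX : IsCompact X) (hc : IsCoerciveCost c)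
    (hB : ∀ γ, (B : EReal) ≤ c γ) (N : ℝ≥0) : IsCompact {γ | excess c B γ ≤ N} := by
  obtain ⟨R, hR0, hR⟩ := hX.isBounded.exists_pos_norm_le
  -- Every path starts within `R` of the origin, so the condition on `γ 0` is vacuous; the maximum
  -- with `1` supplies the positive level that coercivity requires.
  refine (hc.coercive R (max (N + B) 1) hR0 (by positivity)).of_isClosed_subset
    ((lowerSemicontinuous_excess hc.lsc hB).isClosed_preimage _) fun γ hγ => ⟨hR _ (γ 0).2, ?_⟩
  rw [mem_ofPred_eq, ← not_lt, lt_excess_iff hB, not_lt, EReal.coe_nnreal_eq_coe_real,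
    ← EReal.coe_add] at hγ
  exact hγ.trans (EReal.coe_le_coe_iff.2 (le_max_left _ _))

theorem extIntegral_cost_add (hc : LowerSemicontinuous c) (hB : ∀ γ, (B : EReal) ≤ c γ)
    {g : PathSpace X → ℝ} (hg : Continuous g) {C : ℝ} (hC : ∀ γ, |g γ| ≤ C)
    (π : FiniteMeasure (PathSpace X)) :
    extIntegral (π : Measure (PathSpace X)) (fun γ => c γ + (g γ : EReal)) =
      ((∫⁻ γ, excess c B γ ∂(π : Measure (PathSpace X)) : ℝ≥0∞) : EReal) +
        ((B * (π : Measure (PathSpace X)).real univ + ∫ γ, g γ ∂(π : Measure (PathSpace X)) : ℝ)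
          : EReal) := by
  have hgi : Integrable g (π : Measure (PathSpace X)) :=
    integrable_of_continuous_of_bounded hg hC _
  have hf : (fun γ => c γ + (g γ : EReal)) =
      fun γ => (excess c B γ : EReal) + ((B + g γ : ℝ) : EReal) := by
    ext γ
    rw [← coe_excess_add hB γ, EReal.coe_add, add_assoc]
  rw [hf, extIntegral_coe_add (g := fun γ => B + g γ) (lowerSemicontinuous_excess hc hB).measurable (by fun_prop)
    ((integrable_const B).add hgi), integral_add (integrable_const B) hgi, integral_const,
    smul_eq_mul, mul_comm]

variable {θ β : ℝ}

theorem energy_eq_totalEnergy (hX : IsCompact X) (hθ : 0 < θ) (hβ : 0 < β)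
    (hc : LowerSemicontinuous c) (hB : ∀ γ, (B : EReal) ≤ c γ)
    (π : FiniteMeasure (PathSpace X)) :
    energy c θ β (π : Measure (PathSpace X)) = totalEnergy (excess c B) (kernel θ β) B π := by
  have hK := isConvexKernel_kernel hX hθ hβ
  obtain ⟨C, hC⟩ := hK.exists_potential_abs_le π
  rw [energy, extIntegral_cost_add hc hB (g := fun γ => 2 * interaction θ β γ π)
    (continuous_const.mul (hK.continuous_potential π)) (C := 2 * C) (fun γ => by
      rw [abs_mul, abs_two]
      exact mul_le_mul_of_nonneg_left (hC γ) zero_le_two), integral_const_mul]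
  rfl

/-- The pair of endpoint potentials as a bounded continuous function of the path. -/
noncomputable def endpointPotential [CompactSpace X] :
    (C(X, ℝ) × C(X, ℝ)) →ₗ[ℝ] (PathSpace X →ᵇ ℝ) where
  toFun v := (BoundedContinuousFunction.mkOfCompact v.1).compContinuous
      ⟨evalAt 0, continuous_evalAt 0⟩ +
    (BoundedContinuousFunction.mkOfCompact v.2).compContinuous ⟨evalAt 1, continuous_evalAt 1⟩
  map_add' v w := by
    ext γ
    simp only [BoundedContinuousFunction.add_apply, BoundedContinuousFunction.compContinuous_apply,
      BoundedContinuousFunction.mkOfCompact_apply, Prod.fst_add, Prod.snd_add,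
      ContinuousMap.add_apply]
    ring
  map_smul' a v := by
    ext γ
    simp

theorem endpointPotential_apply [CompactSpace X] (v : C(X, ℝ) × C(X, ℝ)) (γ : PathSpace X) :
    endpointPotential v γ = v.1 (evalAt 0 γ) + v.2 (evalAt 1 γ) := rfl

theorem integrable_continuousMap [CompactSpace X] (φ : C(X, ℝ)) (μ : Measure X)
    [IsFiniteMeasure μ] : Integrable φ μ :=
  (BoundedContinuousFunction.mkOfCompact φ).integrable μ

/-- The linear form `(φ, ψ) ↦ ∫ φ dμ₀ + ∫ ψ dμ₁`. -/
noncomputable def marginalForm [CompactSpace X] (μ₀ μ₁ : ProbabilityMeasure X) :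
    (C(X, ℝ) × C(X, ℝ)) →ₗ[ℝ] ℝ where
  toFun v := ∫ x, v.1 x ∂(μ₀ : Measure X) + ∫ y, v.2 y ∂(μ₁ : Measure X)
  map_add' v w := by
    simp only [Prod.fst_add, Prod.snd_add, ContinuousMap.add_apply]
    rw [integral_add (integrable_continuousMap _ _) (integrable_continuousMap _ _),
      integral_add (integrable_continuousMap _ _) (integrable_continuousMap _ _)]
    ring
  map_smul' a v := by
    simp only [Prod.smul_fst, Prod.smul_snd, ContinuousMap.smul_apply, smul_eq_mul,
      integral_const_mul, RingHom.id_apply]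
    ring

theorem integral_endpointPotential [CompactSpace X] (v : C(X, ℝ) × C(X, ℝ))
    (π : Measure (PathSpace X)) [IsFiniteMeasure π] :
    ∫ γ, endpointPotential v γ ∂π =
      ∫ x, v.1 x ∂(π.map (evalAt 0)) + ∫ y, v.2 y ∂(π.map (evalAt 1)) := by
  have hm : ∀ t : unitInterval, Measurable (evalAt t : PathSpace X → X) := fun t =>
    (continuous_evalAt t).measurable
  have hi : ∀ (t : unitInterval) (φ : C(X, ℝ)), Integrable (fun γ => φ (evalAt t γ)) π :=
    fun t φ => (integrable_continuousMap φ (π.map (evalAt t))).comp_measurable (hm t)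
  simp_rw [endpointPotential_apply]
  rw [integral_add (hi 0 v.1) (hi 1 v.2),
    integral_map (hm 0).aemeasurable v.1.continuous.aestronglyMeasurable,
    integral_map (hm 1).aemeasurable v.2.continuous.aestronglyMeasurable]

theorem lagrangian_eq_totalEnergy_add [CompactSpace X] (hX : IsCompact X) (hθ : 0 < θ)
    (hβ : 0 < β) (hc : LowerSemicontinuous c) (hB : ∀ γ, (B : EReal) ≤ c γ)
    (μ₀ μ₁ : ProbabilityMeasure X) (φ ψ : C(X, ℝ)) (π : FiniteMeasure (PathSpace X)) :
    lagrangian c θ β μ₀ μ₁ φ ψ (π : Measure (PathSpace X)) =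
      totalEnergy (excess c B) (kernel θ β) B π +
        ((marginalForm μ₀ μ₁ (φ, ψ) -
          ∫ γ, endpointPotential (φ, ψ) γ ∂(π : Measure (PathSpace X)) : ℝ) : EReal) := by
  have hK := isConvexKernel_kernel hX hθ hβ
  obtain ⟨C, hC⟩ := hK.exists_potential_abs_le π
  have hU := hK.continuous_potential π
  have h2C : ∀ γ, |2 * interaction θ β γ (π : Measure (PathSpace X))| ≤ 2 * C := fun γ => by
    rw [abs_mul, abs_two]
    exact mul_le_mul_of_nonneg_left (hC γ) zero_le_two
  have h2U : Continuous fun γ => 2 * interaction θ β γ (π : Measure (PathSpace X)) :=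
    continuous_const.mul hU
  have hT : ∀ γ : PathSpace X, |endpointPotential (φ, ψ) γ| ≤ ‖endpointPotential (X := X) (φ, ψ)‖ :=
    (endpointPotential (φ, ψ)).norm_coe_le_norm
  rw [lagrangian, reducedLagrangian]
  simp only [← endpointPotential_apply (φ, ψ)]
  rw [extIntegral_cost_add hc hB
    (g := fun γ => 2 * interaction θ β γ (π : Measure (PathSpace X)) - endpointPotential (φ, ψ) γ)
    (h2U.sub (endpointPotential (φ, ψ)).continuous)
    (fun γ => (abs_sub _ _).trans (add_le_add (h2C γ) (hT γ))),
    integral_sub (integrable_of_continuous_of_bounded h2U h2C _)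
      ((endpointPotential (φ, ψ)).integrable _), integral_const_mul, totalEnergy, add_assoc,
    add_assoc, ← EReal.coe_add, ← EReal.coe_add]
  congr 2
  change _ + (2 * crossEnergy (kernel θ β) _ _ - _) + marginalForm μ₀ μ₁ (φ, ψ) = _
  ring

/-- A finite measure whose endpoint integrals agree with those of `μ₀` and `μ₁` is an admissible
plan. -/
theorem exists_mem_pathPlans [CompactSpace X] {μ₀ μ₁ : ProbabilityMeasure X}
    {π : FiniteMeasure (PathSpace X)}
    (h : ∀ v, ∫ γ, endpointPotential v γ ∂(π : Measure (PathSpace X)) = marginalForm μ₀ μ₁ v) :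
    ∃ ρ ∈ pathPlans μ₀ μ₁, (ρ : Measure (PathSpace X)) = π := by
  have h0 : (π : Measure (PathSpace X)).map (evalAt 0) = (μ₀ : Measure X) := by
    refine ext_of_forall_integral_eq_of_IsFiniteMeasure fun f => ?_
    simpa [integral_endpointPotential, marginalForm] using h (f.toContinuousMap, 0)
  have h1 : (π : Measure (PathSpace X)).map (evalAt 1) = (μ₁ : Measure X) := by
    refine ext_of_forall_integral_eq_of_IsFiniteMeasure fun f => ?_
    simpa [integral_endpointPotential, marginalForm] using h (0, f.toContinuousMap)
  -- Total mass one is not a separate constraint: it is inherited from the marginal `μ₀`.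
  have hp : IsProbabilityMeasure (π : Measure (PathSpace X)) := ⟨by
    have := measure_univ (μ := (μ₀ : Measure X))
    rwa [← h0, Measure.map_apply (continuous_evalAt 0).measurable MeasurableSet.univ,
      preimage_univ] at this⟩
  exact ⟨⟨π, hp⟩, ⟨h0, h1⟩, rfl⟩

theorem integral_endpointPotential_of_mem_pathPlans [CompactSpace X] {μ₀ μ₁ : ProbabilityMeasure X}
    {π : ProbabilityMeasure (PathSpace X)} (hπ : π ∈ pathPlans μ₀ μ₁)
    (v : C(X, ℝ) × C(X, ℝ)) :
    ∫ γ, endpointPotential v γ ∂(π : Measure (PathSpace X)) = marginalForm μ₀ μ₁ v := by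
  rw [integral_endpointPotential, hπ.1, hπ.2]
  rfl

end Cost

/-! ### Strong duality -/

/-- Strong duality for the path transport problem with interaction. -/
theorem iInf_energy_eq_iSup_dualFunction {n : ℕ} {X : Set (EuclideanSpace ℝ (Fin n))} (hX : IsCompact X)
    (μ₀ μ₁ : ProbabilityMeasure X) (c : PathSpace X → EReal)
    (hc : IsCoerciveCost c) (θ β : ℝ) (hθ : 0 < θ) (hβ : 0 < β) :
    (⨅ π ∈ pathPlans μ₀ μ₁,
        energy c θ β (π : Measure (PathSpace X))) =
      ⨆ (φ : C(X, ℝ)) (ψ : C(X, ℝ)), dualFunction c θ β μ₀ μ₁ φ ψ := by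
  have : CompactSpace X := isCompact_iff_compactSpace.1 hX
  obtain ⟨B, hB⟩ := hc.bddBelow
  apply le_antisymm
  -- Testing against every real `α` below the primal value also covers the value `+∞`; attainment of
  -- the supremum is not claimed.
  · refine EReal.ge_of_forall_gt_iff_ge.1 fun α hα => ?_
    obtain ⟨⟨φ, ψ⟩, hv⟩ := exists_multiplier_of_lt_totalEnergy (B := B) (α := α)
      (lowerSemicontinuous_excess hc.lsc hB) (isCompact_excess_le hX hc hB)
      (isConvexKernel_kernel hX hθ hβ) endpointPotential (marginalForm μ₀ μ₁) (fun π hπ => by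
        obtain ⟨ρ, hρ, hρπ⟩ := exists_mem_pathPlans hπ
        rw [← energy_eq_totalEnergy hX hθ hβ hc.lsc hB, ← hρπ]
        exact hα.trans_le (iInf₂_le ρ hρ))
    refine le_trans (le_iInf fun π => ?_)
      (le_iSup₂ (f := fun φ ψ => dualFunction c θ β μ₀ μ₁ φ ψ) φ ψ)
    rw [lagrangian_eq_totalEnergy_add hX hθ hβ hc.lsc hB]
    exact hv π
  -- Weak duality: at an admissible plan the Lagrangian is the energy.
  · refine iSup₂_le fun φ ψ => le_iInf₂ fun π hπ => ?_
    refine (iInf_le _ π.toFiniteMeasure).trans ?_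
    rw [lagrangian_eq_totalEnergy_add hX hθ hβ hc.lsc hB]
    have h0 := integral_endpointPotential_of_mem_pathPlans hπ (φ, ψ)
    have hcoe : (π.toFiniteMeasure : Measure (PathSpace X)) = π := rfl
    rw [← energy_eq_totalEnergy hX hθ hβ hc.lsc hB, hcoe, h0, sub_self, EReal.coe_zero, add_zero]

end PathTransport

theorem mainTheorem6 {n : ℕ} {X : Set (EuclideanSpace ℝ (Fin n))} (hX : IsCompact X)
    (μ₀ μ₁ : ProbabilityMeasure X) (c : PathTransport.PathSpace X → EReal)
    (hc : PathTransport.IsCoerciveCost c) (θ β : ℝ) (hθ : 0 < θ) (hβ : 0 < β) :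
    (⨅ π ∈ PathTransport.pathPlans μ₀ μ₁,
        PathTransport.energy c θ β (π : Measure (PathTransport.PathSpace X))) =
      ⨆ (φ : C(X, ℝ)) (ψ : C(X, ℝ)), PathTransport.dualFunction c θ β μ₀ μ₁ φ ψ :=
  PathTransport.iInf_energy_eq_iSup_dualFunction hX μ₀ μ₁ c hc θ β hθ hβ
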